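/- Theorem 1.3. For a finite simple graph $G$, let $\mathrm{Cone}(G)$ be the graph obtained from $G$ by adding a new vertex joined by one edge to every vertex of $G$. For integers $p,s_1,s_2\ge 1$, let $T(p,s_1,s_2)$ be the bi-coconut tree, obtained from a path on vertices $\pi_1,\dots,\pi_p$ by attaching $s_1$ leaves to $\pi_1$ and $s_2$ leaves to $\pi_p$ (if $p=1$, all $s_1+s_2$ leaves are attached to the single vertex $\pi_1$). For a finite connected graph $G$ on $n$ vertices with Laplacian $L_G=D-A$ (the diagonal degree matrix minus the adjacency matrix), let $K(G)=\mathbb{Z}^{n-1}/\operatorname{im}\overline{L_G}$ be its sandpile group, where the reduced Laplacian $\overline{L_G}$ is $L_G$ with the row and column of one vertex deleted (any vertex may be chosen). Write $\mathbb{Z}_m=\mathbb{Z}/m\mathbb{Z}$. Let $(b_n)_{n\ge -2}=(b_n^{(s_1)})_{n\ge -2}$ be defined by $b_{-2}=2^{s_1}$, $b_{-1}=2^{s_1-1}(s_1+2)$ and $b_n=b_{n-1}+b_{n-2}$ for $n\ge 0$, and put $$t(p,s_1,s_2)=2^{s_2-1}\left(2b_{2p-3}^{(s_1)}+s_2\,b_{2p-4}^{(s_1)}\right).$$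 Then, for all integers $p,s_1,s_2\ge 1$, $$a:=2^{1-s_1}\left(2b_{2p-3}^{(s_1)}+s_2\,b_{2p-4}^{(s_1)}\right)=\frac{t(p,s_1,s_2)}{2^{s_1+s_2-2}}$$ is a positive integer, and for every choice of the deleted vertex $$K(\mathrm{Cone}(T(p,s_1,s_2)))\cong\begin{cases}\mathbb{Z}_2^{s_1+s_2-2}\oplus\mathbb{Z}_a & \text{if } p\equiv 1 \pmod 3,\\ \mathbb{Z}_2^{s_1+s_2-3}\oplus\mathbb{Z}_{2a} & \text{if } p\not\equiv 1 \pmod 3,\ s_1 \text{ or } s_2 \text{ is odd, and } (s_1,s_2)\ne(1,1),\\ \mathbb{Z}_a & \text{if } p\not\equiv 1 \pmod 3 \text{ and } s_1=s_2=1,\\ \mathbb{Z}_2^{s_1+s_2-4}\oplus\mathbb{Z}_4\oplus\mathbb{Z}_a & \text{if } p\not\equiv 1 \pmod 3 \text{ and } s_1,s_2 \text{ are both even.}\end{cases}$$ -/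

import Mathlib

/-- The cone over a simple graph `G`: a new vertex `none` (the cone vertex) is added and joined
by one edge to every vertex of `G`. -/
def coneGraph {V : Type*} (G : SimpleGraph V) : SimpleGraph (Option V) where
  Adj
    | some u, some v => G.Adj u v
    | none, some _ => True
    | some _, none => True
    | none, none => False
  symm := ⟨by
    rintro (_ | u) (_ | v) h
    · exact h
    · trivial
    · trivial
    · exact G.adj_symm h⟩
  loopless := ⟨by
    rintro (_ | u) h
    · exact h
    · exact G.irrefl h⟩

instance coneGraph.decidableRelAdj {V : Type*} (G : SimpleGraph V) [DecidableRel G.Adj] :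
    DecidableRel (coneGraph G).Adj
  | some u, some v => inferInstanceAs (Decidable (G.Adj u v))
  | none, some _ => inferInstanceAs (Decidable True)
  | some _, none => inferInstanceAs (Decidable True)
  | none, none => inferInstanceAs (Decidable False)

/-- Vertices of the bi-coconut tree: the `p` path vertices, the `s₁` leaves at the first path vertex
and the `s₂` leaves at the last path vertex. -/
abbrev BiCoconutVertex (p s₁ s₂ : ℕ) : Type :=
  Fin p ⊕ (Fin s₁ ⊕ Fin s₂)

/-- The bi-coconut tree `T(p, s₁, s₂)`: a path on `p` vertices, with `s₁` leaves attached to its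
first vertex and `s₂` leaves attached to its last vertex. -/
def biCoconutTree (p s₁ s₂ : ℕ) : SimpleGraph (BiCoconutVertex p s₁ s₂) where
  Adj
    | .inl i, .inl j => i.val + 1 = j.val ∨ j.val + 1 = i.val
    | .inr (.inl _), .inl i => i.val = 0
    | .inl i, .inr (.inl _) => i.val = 0
    | .inr (.inr _), .inl i => i.val + 1 = p
    | .inl i, .inr (.inr _) => i.val + 1 = p
    | .inr _, .inr _ => False
  symm := ⟨by
    rintro (i | i | i) (j | j | j) h
    · exact Or.symm h
    all_goals exact h⟩
  loopless := ⟨by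
    rintro (i | i | i) h
    · rcases h with h | h <;> omega
    · exact h
    · exact h⟩

instance biCoconutTree.decidableRelAdj (p s₁ s₂ : ℕ) :
    DecidableRel (biCoconutTree p s₁ s₂).Adj
  | .inl i, .inl j => inferInstanceAs (Decidable (i.val + 1 = j.val ∨ j.val + 1 = i.val))
  | .inr (.inl _), .inl i => inferInstanceAs (Decidable (i.val = 0))
  | .inl i, .inr (.inl _) => inferInstanceAs (Decidable (i.val = 0))
  | .inr (.inr _), .inl i => inferInstanceAs (Decidable (i.val + 1 = p))
  | .inl i, .inr (.inr _) => inferInstanceAs (Decidable (i.val + 1 = p))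
  | .inr (.inl _), .inr (.inl _) => inferInstanceAs (Decidable False)
  | .inr (.inl _), .inr (.inr _) => inferInstanceAs (Decidable False)
  | .inr (.inr _), .inr (.inl _) => inferInstanceAs (Decidable False)
  | .inr (.inr _), .inr (.inr _) => inferInstanceAs (Decidable False)

/-- The reduced Laplacian of `G` at the vertex `q`: the Laplacian `D - A` with the row and the
column of `q` deleted. -/
def reducedLaplacian {V : Type*} [Fintype V] [DecidableEq V] (G : SimpleGraph V)
    [DecidableRel G.Adj] (q : V) : Matrix {v : V // v ≠ q} {v : V // v ≠ q} ℤ :=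
  (G.lapMatrix ℤ).submatrix Subtype.val Subtype.val

/-- The sandpile group of a connected graph `G`, presented as the integer cokernel of the reduced
Laplacian at the vertex `q`. -/
abbrev SandpileGroup {V : Type*} [Fintype V] [DecidableEq V] (G : SimpleGraph V)
    [DecidableRel G.Adj] (q : V) : Type _ :=
  ({v : V // v ≠ q} → ℤ) ⧸ LinearMap.range (reducedLaplacian G q).mulVecLin

/-- The sequence `b_n = b_n^{(s)}`, `n ≥ -2`, with the index shifted by two:
`bSeq s k = b_{k - 2}^{(s)}`. -/
def bSeq (s : ℕ) : ℕ → ℚ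
  | 0 => 2 ^ s
  | 1 => (2 : ℚ) ^ ((s : ℤ) - 1) * (s + 2)
  | k + 2 => bSeq s (k + 1) + bSeq s k

/-- The number `t(p, s₁, s₂) = 2^{s₂ - 1} (2 b_{2p-3} + s₂ b_{2p-4})` for `p ≥ 1`, where
`b = b^{(s₁)}`. -/
def tNumber (p s₁ s₂ : ℕ) : ℚ :=
  (2 : ℚ) ^ ((s₂ : ℤ) - 1) * (2 * bSeq s₁ (2 * p - 1) + s₂ * bSeq s₁ (2 * p - 2))

/-! Homomorphisms from the sandpile group to an abelian group `B` are the `B`-valued harmonic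
functions modulo constants, whichever vertex is deleted. So it suffices to describe harmonic
functions on the cone that vanish at the cone vertex.

There a leaf has degree two and an interior path vertex degree three. Hence twice any leaf value is
the value at its neighbour, the differences of leaves at one end are killed by 2, and path values
obey `u (k + 2) = 3 u (k + 1) - u k`. With `y`, `z` one leaf class at each end and `D`, `E` the sums
of the leaf differences, path vertex `k` has value `c_k y + f_k D`. Only two relations remain, `2 z
= c y + f D` at the last path vertex and `c' y - σ z + g D + E = 0` from its own equation
(`sandpile_equiv_leafGroup`). Their integer determinant `2 c' - σ c` is `a`.

The rest depends on parities: `f` is even exactly when `p ≡ 1` mod 3, `c ≡ s₁ f` mod 2, and `σ =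
s₂`. Unless `f` is odd with `s₁`, `s₂` both even, one relation can be used up by a change of
generators (`leafGroup_equiv_of_even_even`, `leafGroup_equiv_of_odd_odd`,
`leafGroup_equiv_of_even_odd`). What is left is ℤ times a power of ℤ/2 modulo one element
(`twistedCyclic_equiv`). In the exceptional case both relations persist and an element of order 4
appears (`leafGroup_equiv_of_all_even`). -/

/-- A function on the vertices of a graph with values in an abelian group is harmonic if its
Laplacian vanishes at every vertex. -/
def IsHarmonic {V B : Type*} [Fintype V] [AddCommGroup B] (G : SimpleGraph V)
    [DecidableRel G.Adj] (x : V → B) : Prop :=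
  ∀ v, ∑ w, (if G.Adj v w then x v - x w else 0) = 0

/-! ### Harmonic functions and the universal property of the sandpile group -/

section Sandpile

variable {V B : Type*} [Fintype V] [AddCommGroup B] (G : SimpleGraph V)
  [DecidableRel G.Adj]

theorem sum_laplacian_eq_zero (x : V → B) :
    ∑ v, ∑ w, (if G.Adj v w then x v - x w else 0) = 0 := by
  have h1 : ∑ v, ∑ w, (if G.Adj v w then x v - x w else 0) =
      ∑ v, ∑ w, (if G.Adj v w then x v else 0) - ∑ v, ∑ w, (if G.Adj v w then x w else 0) := by
    rw [← Finset.sum_sub_distrib]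
    refine Finset.sum_congr rfl fun v _ => ?_
    rw [← Finset.sum_sub_distrib]
    refine Finset.sum_congr rfl fun w _ => ?_
    split_ifs <;> simp
  rw [h1, Finset.sum_comm, sub_eq_zero]
  simp only [G.adj_comm]

variable {G} in
-- The Laplacian values sum to zero by symmetry of adjacency, so one equation is redundant.
theorem IsHarmonic.of_ne {x : V → B} (q : V)
    (h : ∀ v, v ≠ q → ∑ w, (if G.Adj v w then x v - x w else 0) = 0) : IsHarmonic G x := by
  intro v
  by_cases hv : v = q
  · subst hv
    have := sum_laplacian_eq_zero G x
    rwa [Fintype.sum_eq_single v h] at this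
  · exact h v hv

variable {G} in
theorem IsHarmonic.sub_const {x : V → B} (h : IsHarmonic G x) (b : B) :
    IsHarmonic G fun v => x v - b := by
  intro v
  simpa using h v

variable [DecidableEq V]

theorem sum_lapMatrix_smul (x : V → B) (v : V) :
    ∑ w, G.lapMatrix ℤ v w • x w = ∑ w, (if G.Adj v w then x v - x w else 0) := by
  have h2 : ∑ w, (if G.Adj v w then x v else 0) = G.degree v • x v := by
    rw [← Finset.sum_filter, Finset.sum_const, ← G.card_neighborFinset_eq_degree,
      G.neighborFinset_eq_filter]
  have h1 : ∀ w, (if G.Adj v w then x v - x w else 0) =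
      (if G.Adj v w then x v else 0) - (if G.Adj v w then x w else 0) := by
    intro w; split_ifs <;> simp
  simp only [h1, Finset.sum_sub_distrib, h2, SimpleGraph.lapMatrix, Matrix.sub_apply, sub_smul,
    SimpleGraph.degMatrix, Matrix.diagonal_apply, SimpleGraph.adjMatrix_apply, ite_smul, zero_smul,
    one_smul, Finset.sum_ite_eq, Finset.mem_univ, if_true, natCast_zsmul]

variable (q : V)

theorem sum_eq_sum_subtype_ne {F : V → B} (h : F q = 0) :
    ∑ w, F w = ∑ w : {w : V // w ≠ q}, F w := by
  rw [← Finset.sum_erase _ h]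
  exact Finset.sum_subtype _ (by simp) _

/-- The class of a vertex in the sandpile group; it vanishes at the deleted vertex. -/
def vertexClass (v : V) : SandpileGroup G q :=
  if h : v ≠ q then Submodule.Quotient.mk (Pi.single ⟨v, h⟩ 1) else 0

@[simp] theorem vertexClass_self : vertexClass G q q = 0 := by simp [vertexClass]

theorem vertexClass_coe (v : {v : V // v ≠ q}) : vertexClass G q v =
    (LinearMap.range (reducedLaplacian G q).mulVecLin).mkQ (Pi.single v 1) := by
  simp [vertexClass, v.2]

theorem vertexClass_harmonic : IsHarmonic G (vertexClass G q) := by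
  refine IsHarmonic.of_ne q fun v hv => ?_
  rw [← sum_lapMatrix_smul, sum_eq_sum_subtype_ne q (by simp)]
  simp only [vertexClass_coe, ← map_smul, ← map_sum]
  rw [Submodule.mkQ_apply, Submodule.Quotient.mk_eq_zero]
  refine ⟨Pi.single ⟨v, hv⟩ 1, ?_⟩
  ext w
  have hs : (G.lapMatrix ℤ).IsSymm := G.isSymm_lapMatrix ℤ
  have := hs.apply v w.1
  simp [Finset.sum_apply, Pi.single_apply, reducedLaplacian, Matrix.col_apply, this]

theorem sandpile_hom_ext {f g : SandpileGroup G q →+ B}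
    (h : ∀ v, f (vertexClass G q v) = g (vertexClass G q v)) : f = g := by
  have key : f.toIntLinearMap = g.toIntLinearMap := by
    apply Submodule.linearMap_qext
    apply LinearMap.pi_ext'
    intro v
    ext
    simpa [vertexClass_coe] using h v
  ext x
  exact congrArg (fun F => F x) key

variable {G} in
-- The Laplacian is symmetric, so its columns impose exactly the harmonicity equations, and these
-- are unchanged by subtracting the constant `x q`.
theorem IsHarmonic.exists_hom {x : V → B} (hx : IsHarmonic G x) :
    ∃ f : SandpileGroup G q →+ B, ∀ v, f (vertexClass G q v) = x v - x q := by
  let F : ({v : V // v ≠ q} → ℤ) →ₗ[ℤ] B := Fintype.linearCombination ℤ fun v => x v - x q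
  have hF : LinearMap.range (reducedLaplacian G q).mulVecLin ≤ LinearMap.ker F := by
    rw [LinearMap.range_le_ker_iff]
    apply LinearMap.pi_ext'
    intro v
    ext
    have h1 := (sum_lapMatrix_smul G (fun w => x w - x q) v).trans (hx.sub_const (x q) v)
    rw [sum_eq_sum_subtype_ne q (by simp)] at h1
    have hs : (G.lapMatrix ℤ).IsSymm := G.isSymm_lapMatrix ℤ
    have h2 : ∀ w, G.lapMatrix ℤ w v = G.lapMatrix ℤ v w := fun w => hs.apply v w
    simpa [F, Fintype.linearCombination_apply, reducedLaplacian, Matrix.col_apply, h2] using h1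
  refine ⟨(Submodule.liftQ _ F hF).toAddMonoidHom, fun v => ?_⟩
  by_cases h : v = q
  · subst h; simp
  · have := vertexClass_coe G q ⟨v, h⟩
    simp only at this
    rw [this]
    simp [F, Fintype.linearCombination_apply, Pi.single_apply]

end Sandpile

/-! ### The recurrence along the path -/

section PathSequence

variable {B : Type*} [AddCommGroup B]

/-- The sequence with the given two initial values and `u (k + 2) = 3 u (k + 1) - u k`. -/
def pathSeq (a b : B) : ℕ → B
  | 0 => a
  | 1 => b
  | k + 2 => 3 • pathSeq a b (k + 1) - pathSeq a b k

theorem pathSeq_add_two (a b : B) (k : ℕ) :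
    pathSeq a b (k + 2) = 3 • pathSeq a b (k + 1) - pathSeq a b k := rfl

theorem pathSeq_combination (c₀ c₁ f₀ f₁ : ℤ) (y d : B) (k : ℕ) :
    pathSeq (c₀ • y + f₀ • d) (c₁ • y + f₁ • d) k =
      pathSeq c₀ c₁ k • y + pathSeq f₀ f₁ k • d := by
  induction k using Nat.strong_induction_on with
  | _ k ih =>
    match k with
    | 0 => rfl
    | 1 => rfl
    | k + 2 =>
      rw [pathSeq_add_two, ih k (by omega), ih (k + 1) (by omega), pathSeq_add_two,
        pathSeq_add_two]
      module

end PathSequence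

/-! ### Harmonic functions on the cone over a bi-coconut tree -/

section Tree

variable {B : Type*} [AddCommGroup B] {n s₁ s₂ : ℕ}

/-- A function on the cone over a bi-coconut tree that vanishes at the cone vertex, given by its
values on the path and on the two families of leaves. -/
def treePotential (P : ℕ → B) (l : Fin s₁ → B) (m : Fin s₂ → B) :
    Option (BiCoconutVertex (n + 1) s₁ s₂) → B
  | none => 0
  | some (.inl i) => P i
  | some (.inr (.inl i)) => l i
  | some (.inr (.inr i)) => m i

theorem sum_path_neighbours (P : ℕ → B) (n j : ℕ) (hj : j ≤ n) :
    ∑ i : Fin (n + 1), (if j + 1 = i.val ∨ i.val + 1 = j then P j - P i else 0) =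
      (if j + 1 ≤ n then P j - P (j + 1) else 0) + (if 0 < j then P j - P (j - 1) else 0) := by
  rw [Fin.sum_univ_eq_sum_range (fun i => if j + 1 = i ∨ i + 1 = j then P j - P i else 0)]
  -- Subtraction is truncated: for `j = 0` the test `j - 1 = i` holds at `i = 0`, hence the inner
  -- test `0 < j`.
  have h : ∀ i, (if j + 1 = i ∨ i + 1 = j then P j - P i else 0) =
      (if j + 1 = i then P j - P i else 0) +
        (if j - 1 = i then (if 0 < j then P j - P i else 0) else 0) := by
    intro i
    split_ifs <;> first | omega | simp
  simp only [h, Finset.sum_add_distrib, Finset.sum_ite_eq, Finset.mem_range]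
  congr 1
  · simp
  · rw [if_pos (by omega)]

/-- The equation at the cone vertex follows from the others. In the path equation the leading `P j`
is the edge to the cone vertex; both end terms are present when `n = 0`. -/
theorem treePotential_harmonic_iff (P : ℕ → B) (l : Fin s₁ → B) (m : Fin s₂ → B) :
    IsHarmonic (coneGraph (biCoconutTree (n + 1) s₁ s₂)) (treePotential P l m) ↔
      (∀ i, 2 • l i = P 0) ∧ (∀ i, 2 • m i = P n) ∧
      ∀ j ≤ n, P j + ((if j + 1 ≤ n then P j - P (j + 1) else 0) +
        (if 0 < j then P j - P (j - 1) else 0)) +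
        (if j = 0 then s₁ • P j - ∑ i, l i else 0) +
        (if j = n then s₂ • P j - ∑ i, m i else 0) = 0 := by
  have hnone : IsHarmonic (coneGraph (biCoconutTree (n + 1) s₁ s₂)) (treePotential P l m) ↔
      ∀ v, ∑ w, (if (coneGraph (biCoconutTree (n + 1) s₁ s₂)).Adj (some v) w then
        treePotential P l m (some v) - treePotential P l m w else 0) = 0 := by
    refine ⟨fun h v => h (some v), fun h => IsHarmonic.of_ne none fun v hv => ?_⟩
    obtain ⟨v, rfl⟩ := Option.ne_none_iff_exists'.1 hv
    exact h v
  rw [hnone]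
  simp only [Sum.forall, Fintype.sum_option, Fintype.sum_sum_type]
  have e1 : ∀ (i : Fin (n + 1)), (i.val = 0) ↔ (i = 0) := fun i => by
    rw [Fin.ext_iff]; rfl
  have e2 : ∀ (i : Fin (n + 1)), (i.val = n) ↔ (i = Fin.last n) := fun i => by
    rw [Fin.ext_iff]; simp
  rw [and_comm, and_assoc]
  refine and_congr ?_ (and_congr ?_ ?_)
  · refine forall_congr' fun i => ?_
    simp [coneGraph, biCoconutTree, treePotential, e1]
    rw [← sub_eq_zero (a := 2 • l i), two_nsmul, add_sub_assoc]
  · refine forall_congr' fun i => ?_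
    simp [coneGraph, biCoconutTree, treePotential, e2]
    rw [← sub_eq_zero (a := 2 • m i), two_nsmul, add_sub_assoc]
  · rw [Fin.forall_iff]
    simp only [Nat.lt_succ_iff]
    refine forall₂_congr fun j hj => ?_
    rw [← sum_path_neighbours P n j hj]
    simp [coneGraph, biCoconutTree, treePotential]
    simp only [add_assoc]

theorem path_eq_pathSeq {P : ℕ → B} {l : Fin s₁ → B} {m : Fin s₂ → B}
    (h : IsHarmonic (coneGraph (biCoconutTree (n + 1) s₁ s₂)) (treePotential P l m)) (j : ℕ)
    (hj : j ≤ n) : P j = pathSeq (P 0) ((s₁ + 2) • P 0 - ∑ i, l i) j := by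
  rw [treePotential_harmonic_iff] at h
  obtain ⟨-, -, h⟩ := h
  induction j using Nat.strong_induction_on with
  | _ k ih =>
    match k with
    | 0 => rfl
    | 1 =>
      have := h 0 (by omega)
      rw [if_pos (by omega), if_neg (by omega), if_pos rfl, if_neg (by omega)] at this
      rw [← sub_eq_zero, ← neg_eq_zero, ← this, pathSeq]
      module
    | k + 2 =>
      rw [pathSeq_add_two, ← ih k (by omega) (by omega), ← ih (k + 1) (by omega) (by omega)]
      have := h (k + 1) (by omega)
      rw [if_pos (by omega), if_pos (by omega), if_neg (by omega), if_neg (by omega)] at this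
      rw [← sub_eq_zero, ← neg_eq_zero, ← this]
      simp only [Nat.add_sub_cancel]
      module

/-- Prolonging the recurrence one step beyond the path replaces the missing neighbour of the last
vertex, and gives its equation a form that also covers `n = 0`. -/
theorem treePotential_end {P : ℕ → B} {l : Fin s₁ → B} {m : Fin s₂ → B}
    (h : IsHarmonic (coneGraph (biCoconutTree (n + 1) s₁ s₂)) (treePotential P l m)) :
    pathSeq (P 0) ((s₁ + 2) • P 0 - ∑ i, l i) (n + 1) + s₂ • P n = ∑ i, m i + P n := by
  have hP := path_eq_pathSeq h
  rw [treePotential_harmonic_iff] at h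
  obtain ⟨-, -, h⟩ := h
  have := h n le_rfl
  rw [if_neg (by omega), if_pos rfl] at this
  rw [← sub_eq_zero, ← this]
  cases n with
  | zero => simp [pathSeq]; module
  | succ k =>
    rw [pathSeq_add_two, ← hP k (by omega), ← hP (k + 1) le_rfl]
    rw [if_pos (by omega), if_neg (by omega)]
    simp only [Nat.add_sub_cancel]
    module

theorem treePotential_pathSeq_harmonic {l : Fin s₁ → B} {m : Fin s₂ → B} {a : B}
    {Q : ℕ → B} (hQ : Q = pathSeq a ((s₁ + 2) • a - ∑ i, l i))
    (hl : ∀ i, 2 • l i = a) (hm : ∀ i, 2 • m i = Q n)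
    (hend : Q (n + 1) + s₂ • Q n = ∑ i, m i + Q n) :
    IsHarmonic (coneGraph (biCoconutTree (n + 1) s₁ s₂)) (treePotential Q l m) := by
  rw [treePotential_harmonic_iff]
  have h0 : Q 0 = a := by rw [hQ]; rfl
  have h1 : Q 1 = (s₁ + 2) • a - ∑ i, l i := by rw [hQ]; rfl
  have h2 : ∀ k, Q (k + 2) = 3 • Q (k + 1) - Q k := by rw [hQ]; exact fun _ => rfl
  refine ⟨fun i => by rw [hl, h0], hm, fun j hj => ?_⟩
  rw [← sub_eq_zero] at hend
  rcases j with _ | j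
  · rcases n with _ | n
    · simp [h0] at hend ⊢
      rw [← hend, h1]
      module
    · simp [h0, h1]
      module
  · rcases hj.eq_or_lt with rfl | hj
    · simp [h2] at hend ⊢
      rw [← hend]
      module
    · rw [if_pos (by omega), if_pos (by omega), if_neg (by omega), if_neg (by omega), h2]
      simp only [Nat.add_sub_cancel]
      module

end Tree

/-! ### Homomorphisms out of powers of ℤ/2 -/

section TorsionHom

variable {B : Type*} [AddCommGroup B] {ι : Type*} [Fintype ι]

/-- The homomorphism from a power of `ZMod 2` sending the basis vectors to given elements of
order dividing two. -/
def torsionHom (d : ι → B) (hd : ∀ i, 2 • d i = 0) : (ι → ZMod 2) →+ B :=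
  ∑ i, (ZMod.lift 2 ⟨zmultiplesHom B (d i), by simpa [← natCast_zsmul] using hd i⟩).comp
    (Pi.evalAddMonoidHom (fun _ => ZMod 2) i)

variable {d : ι → B} {hd : ∀ i, 2 • d i = 0}

theorem zmod_two_lift_one {b : B} (hb : zmultiplesHom B b (2 : ℕ) = 0) :
    ZMod.lift 2 ⟨zmultiplesHom B b, hb⟩ 1 = b := by
  have := ZMod.lift_coe 2 ⟨zmultiplesHom B b, hb⟩ 1
  simpa using this

theorem torsionHom_single [DecidableEq ι] (i : ι) : torsionHom d hd (Pi.single i 1) = d i := by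
  rw [torsionHom, AddMonoidHom.finsetSum_apply, Finset.sum_eq_single i]
  · simp [zmod_two_lift_one]
  · intro j _ hj
    simp [hj]
  · simp

theorem torsionHom_one : torsionHom d hd 1 = ∑ i, d i := by
  simp [torsionHom, AddMonoidHom.finsetSum_apply, zmod_two_lift_one]

theorem torsionHom_ext [DecidableEq ι] {f g : (ι → ZMod 2) →+ B}
    (h : ∀ i, f (Pi.single i 1) = g (Pi.single i 1)) : f = g := by
  refine AddMonoidHom.functions_ext _ _ _ fun i x => ?_
  obtain ⟨k, rfl⟩ := ZMod.intCast_surjective x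
  have : (Pi.single i (k : ZMod 2) : ι → ZMod 2) = k • Pi.single i 1 := by
    rw [← Pi.single_smul]; simp
  rw [this, map_zsmul, map_zsmul, h]

end TorsionHom

/-! ### Presentation of the sandpile group by leaf classes -/

section LeafGroup

variable {A₁ A₂ B : Type*} [AddCommGroup A₁] [AddCommGroup A₂] [AddCommGroup B]

/-- The subgroup generated by the two relations between the leaf classes of a cone over a
bi-coconut tree. -/
def leafRelations (c c' σ f g : ℤ) (D : A₁) (E : A₂) : AddSubgroup (ℤ × ℤ × A₁ × A₂) :=
  AddSubgroup.closure {(c, -2, f • D, 0), (c', -σ, g • D, E)}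

theorem pathSeq_map {C : Type*} [AddCommGroup C] (F : B →+ C) (a b : B) (k : ℕ) :
    F (pathSeq a b k) = pathSeq (F a) (F b) k := by
  induction k using Nat.strong_induction_on with
  | _ k ih =>
    match k with
    | 0 => rfl
    | 1 => rfl
    | k + 2 => simp [pathSeq_add_two, ih k (by omega), ih (k + 1) (by omega)]

/-- With `D` the sum of the leaf differences, the leaves sum to `(k + 1) • l 0 + D`, so the two
initial values are `2 • l 0` and `(k + 5) • l 0 - D`. -/
theorem leaf_pathSeq {k : ℕ} (l : Fin (k + 1) → B) (j : ℕ) :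
    pathSeq (2 • l 0) ((k + 1 + 2) • (2 • l 0) - ∑ i, l i) j =
      pathSeq (2 : ℤ) (k + 5) j • l 0 + pathSeq (0 : ℤ) (-1) j • ∑ i, (l (Fin.succ i) - l 0) := by
  rw [← pathSeq_combination]
  congr 1
  · module
  · rw [Fin.sum_univ_succ, Finset.sum_sub_distrib, Finset.sum_const, Finset.card_univ,
      Fintype.card_fin]
    module

/-- The homomorphism determined by the images of the generators. -/
def leafHom {κ₁ κ₂ : ℕ} (y z : B) (F₁ : (Fin κ₁ → ZMod 2) →+ B) (F₂ : (Fin κ₂ → ZMod 2) →+ B) :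
    ℤ × ℤ × (Fin κ₁ → ZMod 2) × (Fin κ₂ → ZMod 2) →+ B :=
  (zmultiplesHom B y).coprod ((zmultiplesHom B z).coprod (F₁.coprod F₂))

theorem leafRelations_hom_ext {κ₁ κ₂ : ℕ}
    {H : AddSubgroup (ℤ × ℤ × (Fin κ₁ → ZMod 2) × (Fin κ₂ → ZMod 2))}
    {F G : (ℤ × ℤ × (Fin κ₁ → ZMod 2) × (Fin κ₂ → ZMod 2)) ⧸ H →+ B}
    (hy : F ((1, 0, 0, 0) : ℤ × ℤ × (Fin κ₁ → ZMod 2) × (Fin κ₂ → ZMod 2)) =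
      G ((1, 0, 0, 0) : ℤ × ℤ × (Fin κ₁ → ZMod 2) × (Fin κ₂ → ZMod 2)))
    (hz : F ((0, 1, 0, 0) : ℤ × ℤ × (Fin κ₁ → ZMod 2) × (Fin κ₂ → ZMod 2)) =
      G ((0, 1, 0, 0) : ℤ × ℤ × (Fin κ₁ → ZMod 2) × (Fin κ₂ → ZMod 2)))
    (hd : ∀ i, F ((0, 0, Pi.single i 1, 0) : ℤ × ℤ × (Fin κ₁ → ZMod 2) × (Fin κ₂ → ZMod 2)) =
      G ((0, 0, Pi.single i 1, 0) : ℤ × ℤ × (Fin κ₁ → ZMod 2) × (Fin κ₂ → ZMod 2)))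
    (he : ∀ i, F ((0, 0, 0, Pi.single i 1) : ℤ × ℤ × (Fin κ₁ → ZMod 2) × (Fin κ₂ → ZMod 2)) =
      G ((0, 0, 0, Pi.single i 1) : ℤ × ℤ × (Fin κ₁ → ZMod 2) × (Fin κ₂ → ZMod 2))) :
    F = G := by
  apply QuotientAddGroup.addMonoidHom_ext
  set f := F.comp (QuotientAddGroup.mk' H)
  set g := G.comp (QuotientAddGroup.mk' H)
  let i₁ : (Fin κ₁ → ZMod 2) →+ ℤ × ℤ × (Fin κ₁ → ZMod 2) × (Fin κ₂ → ZMod 2) :=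
    (AddMonoidHom.inr _ _).comp ((AddMonoidHom.inr _ _).comp (AddMonoidHom.inl _ _))
  let i₂ : (Fin κ₂ → ZMod 2) →+ ℤ × ℤ × (Fin κ₁ → ZMod 2) × (Fin κ₂ → ZMod 2) :=
    (AddMonoidHom.inr _ _).comp ((AddMonoidHom.inr _ _).comp (AddMonoidHom.inr _ _))
  have h1 : f.comp i₁ = g.comp i₁ := torsionHom_ext hd
  have h2 : f.comp i₂ = g.comp i₂ := torsionHom_ext he
  ext ⟨i, j, v, w⟩
  have hx : ((i, j, v, w) : ℤ × ℤ × (Fin κ₁ → ZMod 2) × (Fin κ₂ → ZMod 2)) =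
      i • (1, 0, 0, 0) + j • (0, 1, 0, 0) + i₁ v + i₂ w := by
    simp [i₁, i₂]
  have hv := DFunLike.congr_fun h1 v
  have hw := DFunLike.congr_fun h2 w
  simp only [AddMonoidHom.comp_apply] at hv hw
  have hy' : f (1, 0, 0, 0) = g (1, 0, 0, 0) := hy
  have hz' : f (0, 1, 0, 0) = g (0, 1, 0, 0) := hz
  rw [hx]
  simp only [map_add, map_zsmul, hv, hw, hy', hz']

variable {n κ₁ κ₂ : ℕ}

/-- The relations between the leaf classes of the cone over the bi-coconut tree with `n + 1` path
vertices and `κ₁ + 1`, `κ₂ + 1` leaves at the two ends: the generators are one leaf class at each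
end and the differences between this leaf and the others. -/
abbrev coneRelations (n κ₁ κ₂ : ℕ) :
    AddSubgroup (ℤ × ℤ × (Fin κ₁ → ZMod 2) × (Fin κ₂ → ZMod 2)) :=
  leafRelations (pathSeq (2 : ℤ) (κ₁ + 5) n)
    (pathSeq (2 : ℤ) (κ₁ + 5) (n + 1) + κ₂ * pathSeq (2 : ℤ) (κ₁ + 5) n) (κ₂ + 1)
    (pathSeq (0 : ℤ) (-1) n) (pathSeq (0 : ℤ) (-1) (n + 1) + κ₂ * pathSeq (0 : ℤ) (-1) n) 1 1

theorem exists_leafHom_of_harmonic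
    {X : Option (BiCoconutVertex (n + 1) (κ₁ + 1) (κ₂ + 1)) → B}
    (hX : IsHarmonic (coneGraph (biCoconutTree (n + 1) (κ₁ + 1) (κ₂ + 1))) X) (h0 : X none = 0) :
    ∃ G : (ℤ × ℤ × (Fin κ₁ → ZMod 2) × (Fin κ₂ → ZMod 2)) ⧸ coneRelations n κ₁ κ₂ →+ B,
      G ((1, 0, 0, 0) : ℤ × ℤ × (Fin κ₁ → ZMod 2) × (Fin κ₂ → ZMod 2)) =
        X (some (.inr (.inl 0))) ∧
      G ((0, 1, 0, 0) : ℤ × ℤ × (Fin κ₁ → ZMod 2) × (Fin κ₂ → ZMod 2)) =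
        X (some (.inr (.inr 0))) ∧
      (∀ i, G ((0, 0, Pi.single i 1, 0) : ℤ × ℤ × (Fin κ₁ → ZMod 2) × (Fin κ₂ → ZMod 2)) =
        X (some (.inr (.inl i.succ))) - X (some (.inr (.inl 0)))) ∧
      (∀ i, G ((0, 0, 0, Pi.single i 1) : ℤ × ℤ × (Fin κ₁ → ZMod 2) × (Fin κ₂ → ZMod 2)) =
        X (some (.inr (.inr i.succ))) - X (some (.inr (.inr 0)))) ∧
      ∀ j : Fin (n + 1), X (some (.inl j)) =
        pathSeq (2 • X (some (.inr (.inl 0)))) ((κ₁ + 1 + 2) • (2 • X (some (.inr (.inl 0)))) -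
          ∑ i, X (some (.inr (.inl i)))) j := by
  set l : Fin (κ₁ + 1) → B := fun i => X (some (.inr (.inl i))) with hl
  set m : Fin (κ₂ + 1) → B := fun i => X (some (.inr (.inr i))) with hm
  set P : ℕ → B := fun j => if h : j < n + 1 then X (some (.inl ⟨j, h⟩)) else 0 with hP
  have hXP : X = treePotential P l m := by
    funext v
    rcases v with _ | v | v | v
    · exact h0
    · simp only [treePotential, hP]
      rw [dif_pos v.2]
    · rfl
    · rfl
  rw [hXP] at hX
  have hpath := path_eq_pathSeq hX
  have hend := treePotential_end hX
  obtain ⟨h1, h2, -⟩ := (treePotential_harmonic_iff _ _ _).1 hX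
  have hd : ∀ i, 2 • (l (Fin.succ i) - l 0) = 0 := fun i => by rw [smul_sub, h1, h1, sub_self]
  have he : ∀ i, 2 • (m (Fin.succ i) - m 0) = 0 := fun i => by rw [smul_sub, h2, h2, sub_self]
  have hsum : ∑ i, m i = (κ₂ + 1) • m 0 + ∑ i, (m (Fin.succ i) - m 0) := by
    rw [Fin.sum_univ_succ, Finset.sum_sub_distrib, Finset.sum_const, Finset.card_univ,
      Fintype.card_fin]
    module
  have hE : 2 • ∑ i, (m (Fin.succ i) - m 0) = 0 := by
    rw [Finset.smul_sum]; exact Finset.sum_eq_zero fun i _ => he i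
  have hPn := hpath n le_rfl
  rw [← h1 0, leaf_pathSeq] at hPn
  rw [hsum, ← h1 0, leaf_pathSeq, hPn] at hend
  have h20 := h2 0
  rw [hPn] at h20
  let G := leafHom (l 0) (m 0) (torsionHom _ hd) (torsionHom _ he)
  have hG : coneRelations n κ₁ κ₂ ≤ G.ker := by
    rw [coneRelations, leafRelations, AddSubgroup.closure_le]
    rintro _ (rfl | rfl)
    · simp only [SetLike.mem_coe, AddMonoidHom.mem_ker, G, leafHom, AddMonoidHom.coprod_apply,
        zmultiplesHom_apply, map_zsmul, torsionHom_one, map_zero]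
      linear_combination (norm := module) -h20
    · simp only [SetLike.mem_coe, AddMonoidHom.mem_ker, G, leafHom, AddMonoidHom.coprod_apply,
        zmultiplesHom_apply, map_zsmul, torsionHom_one]
      -- `hend` yields the relation with the opposite sign on the sum of the second leaf
      -- differences; that sum is killed by 2.
      linear_combination (norm := module) hend + hE
  refine ⟨QuotientAddGroup.lift _ G hG, ?_, ?_, fun i => ?_, fun i => ?_, fun j => ?_⟩
  · simp [G, leafHom, hl]
  · simp [G, leafHom, hm]
  · simp [G, leafHom, torsionHom_single, hl]
  · simp [G, leafHom, torsionHom_single, hm]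
  · have := hpath j (by omega)
    rw [← h1 0] at this
    simp only [hP] at this
    rw [dif_pos j.2] at this
    exact this

/-- This is the universal normalized harmonic function: the generators serve as leaf values, the
recurrence supplies the path, and the two relations are what the far end requires. -/
theorem exists_harmonic_of_relations :
    ∃ ξ : Option (BiCoconutVertex (n + 1) (κ₁ + 1) (κ₂ + 1)) →
        (ℤ × ℤ × (Fin κ₁ → ZMod 2) × (Fin κ₂ → ZMod 2)) ⧸ coneRelations n κ₁ κ₂,
      IsHarmonic (coneGraph (biCoconutTree (n + 1) (κ₁ + 1) (κ₂ + 1))) ξ ∧ ξ none = 0 ∧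
      ξ (some (.inr (.inl 0))) =
        ((1, 0, 0, 0) : ℤ × ℤ × (Fin κ₁ → ZMod 2) × (Fin κ₂ → ZMod 2)) ∧
      ξ (some (.inr (.inr 0))) =
        ((0, 1, 0, 0) : ℤ × ℤ × (Fin κ₁ → ZMod 2) × (Fin κ₂ → ZMod 2)) ∧
      (∀ i, ξ (some (.inr (.inl (Fin.succ i)))) - ξ (some (.inr (.inl 0))) =
        ((0, 0, Pi.single i 1, 0) : ℤ × ℤ × (Fin κ₁ → ZMod 2) × (Fin κ₂ → ZMod 2))) ∧
      (∀ i, ξ (some (.inr (.inr (Fin.succ i)))) - ξ (some (.inr (.inr 0))) =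
        ((0, 0, 0, Pi.single i 1) : ℤ × ℤ × (Fin κ₁ → ZMod 2) × (Fin κ₂ → ZMod 2))) := by
  let mk : ℤ × ℤ × (Fin κ₁ → ZMod 2) × (Fin κ₂ → ZMod 2) →+ _ :=
    QuotientAddGroup.mk' (coneRelations n κ₁ κ₂)
  let l : Fin (κ₁ + 1) → _ := Fin.cons (mk (1, 0, 0, 0)) fun i => mk (1, 0, Pi.single i 1, 0)
  let m : Fin (κ₂ + 1) → _ := Fin.cons (mk (0, 1, 0, 0)) fun i => mk (0, 1, 0, Pi.single i 1)
  have hr1 : mk (pathSeq (2 : ℤ) (κ₁ + 5) n, -2, pathSeq (0 : ℤ) (-1) n • 1, 0) = 0 :=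
    (QuotientAddGroup.eq_zero_iff _).2 (AddSubgroup.subset_closure (Or.inl rfl))
  have hr2 : mk (pathSeq (2 : ℤ) (κ₁ + 5) (n + 1) + κ₂ * pathSeq (2 : ℤ) (κ₁ + 5) n, -(κ₂ + 1),
      (pathSeq (0 : ℤ) (-1) (n + 1) + κ₂ * pathSeq (0 : ℤ) (-1) n) • 1, 1) = 0 :=
    (QuotientAddGroup.eq_zero_iff _).2 (AddSubgroup.subset_closure (Or.inr rfl))
  have two1 : ∀ v : Fin κ₁ → ZMod 2, v + v = 0 := fun v => by
    funext i; exact CharTwo.add_self_eq_zero _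
  have two2 : ∀ v : Fin κ₂ → ZMod 2, v + v = 0 := fun v => by
    funext i; exact CharTwo.add_self_eq_zero _
  have hl : ∀ i, 2 • l i = 2 • l 0 := by
    intro i
    cases i using Fin.cases with
    | zero => rfl
    | succ i => simp [l, ← map_nsmul, -nsmul_eq_mul, two_nsmul, two1]
  have hm : ∀ i, 2 • m i = 2 • m 0 := by
    intro i
    cases i using Fin.cases with
    | zero => rfl
    | succ i => simp [m, ← map_nsmul, -nsmul_eq_mul, two_nsmul, two2]
  have hdl : ∀ i : Fin κ₁, l i.succ - l 0 = mk (0, 0, Pi.single i 1, 0) := fun i => by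
    simp [l, ← map_sub]
  have hdm : ∀ i : Fin κ₂, m i.succ - m 0 = mk (0, 0, 0, Pi.single i 1) := fun i => by
    simp [m, ← map_sub]
  have hsl : ∑ i : Fin κ₁, (l i.succ - l 0) = mk (0, 0, 1, 0) := by
    simp only [hdl, ← map_sum]
    congr 1
    ext <;> simp [Prod.fst_sum, Prod.snd_sum, Finset.sum_apply]
  have hsm : ∑ i : Fin κ₂, (m i.succ - m 0) = mk (0, 0, 0, 1) := by
    simp only [hdm, ← map_sum]
    congr 1
    ext <;> simp [Prod.fst_sum, Prod.snd_sum, Finset.sum_apply]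
  have hr1' : pathSeq (2 : ℤ) (κ₁ + 5) n • l 0 + (-2 : ℤ) • m 0 +
      pathSeq (0 : ℤ) (-1) n • mk (0, 0, 1, 0) = 0 := by
    rw [← hr1]
    simp only [l, m, Fin.cons_zero, ← map_zsmul, ← map_add]
    simp
  have hr2' : (pathSeq (2 : ℤ) (κ₁ + 5) (n + 1) + κ₂ * pathSeq (2 : ℤ) (κ₁ + 5) n) • l 0 +
      (-(κ₂ + 1 : ℤ)) • m 0 +
      (pathSeq (0 : ℤ) (-1) (n + 1) + κ₂ * pathSeq (0 : ℤ) (-1) n) • mk (0, 0, 1, 0) +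
      mk (0, 0, 0, 1) = 0 := by
    rw [← hr2]
    simp only [l, m, Fin.cons_zero, ← map_zsmul, ← map_add]
    simp
  have hE : 2 • mk (0, 0, 0, 1) = 0 := by
    rw [← map_nsmul, two_nsmul]
    simp only [Prod.mk_add_mk, add_zero, two2]
    exact map_zero mk
  have hs : ∑ i, m i = (κ₂ + 1) • m 0 + mk (0, 0, 0, 1) := by
    rw [← hsm, Fin.sum_univ_succ, Finset.sum_sub_distrib, Finset.sum_const, Finset.card_univ,
      Fintype.card_fin]
    module
  refine ⟨treePotential (pathSeq (2 • l 0) ((κ₁ + 1 + 2) • (2 • l 0) - ∑ i, l i)) l m,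
    treePotential_pathSeq_harmonic (a := 2 • l 0) rfl hl ?_ ?_, rfl, rfl, rfl, hdl, hdm⟩
  · intro i
    rw [hm, leaf_pathSeq, hsl]
    linear_combination (norm := module) -hr1'
  · rw [leaf_pathSeq, leaf_pathSeq, hsl, hs]
    linear_combination (norm := module) hr2' - hE

/-- Both groups carry a universal harmonic function, so the two induced homomorphisms are mutually
inverse; this is checked on generators. -/
theorem sandpile_equiv_leafGroup
    (q : Option (BiCoconutVertex (n + 1) (κ₁ + 1) (κ₂ + 1))) :
    Nonempty (SandpileGroup (coneGraph (biCoconutTree (n + 1) (κ₁ + 1) (κ₂ + 1))) q ≃+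
      (ℤ × ℤ × (Fin κ₁ → ZMod 2) × (Fin κ₂ → ZMod 2)) ⧸ coneRelations n κ₁ κ₂) := by
  have hX := (vertexClass_harmonic
    (coneGraph (biCoconutTree (n + 1) (κ₁ + 1) (κ₂ + 1))) q).sub_const (vertexClass _ q none)
  obtain ⟨G, hGy, hGz, hGd, hGe, hGp⟩ := exists_leafHom_of_harmonic hX (sub_self _)
  obtain ⟨ξ, hξ, h0, hξy, hξz, hξd, hξe⟩ :=
    exists_harmonic_of_relations (n := n) (κ₁ := κ₁) (κ₂ := κ₂)
  -- Only the formula for path values is needed: it reduces the comparison at path vertices to the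
  -- leaves.
  obtain ⟨-, -, -, -, -, hξp⟩ := exists_leafHom_of_harmonic hξ h0
  obtain ⟨F, hF⟩ := hξ.exists_hom q
  have hFX : ∀ v, F (vertexClass _ q v - vertexClass _ q none) = ξ v := fun v => by
    rw [map_sub, hF, hF, h0]; abel
  have hl : ∀ i, G (ξ (some (.inr (.inl i)))) =
      vertexClass _ q (some (.inr (.inl i))) - vertexClass _ q none := by
    intro i
    cases i using Fin.cases with
    | zero => rw [hξy, hGy]
    | succ i => rw [← sub_add_cancel (ξ _) (ξ (some (.inr (.inl 0)))), hξd, hξy, map_add, hGy,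
        hGd, sub_add_cancel]
  have hm : ∀ i, G (ξ (some (.inr (.inr i)))) =
      vertexClass _ q (some (.inr (.inr i))) - vertexClass _ q none := by
    intro i
    cases i using Fin.cases with
    | zero => rw [hξz, hGz]
    | succ i => rw [← sub_add_cancel (ξ _) (ξ (some (.inr (.inr 0)))), hξe, hξz, map_add, hGz,
        hGe, sub_add_cancel]
  have hGξ : ∀ v, G (ξ v) = vertexClass _ q v - vertexClass _ q none := by
    rintro (_ | v | v | v)
    · rw [h0, map_zero, sub_self]
    · rw [hξp, pathSeq_map, hGp]
      simp only [map_sub, map_nsmul, map_sum, hl]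
    · exact hl v
    · exact hm v
  refine ⟨AddMonoidHom.toAddEquiv F G ?_ ?_⟩
  · refine sandpile_hom_ext _ _ fun v => ?_
    simp [hF, hGξ]
  · refine leafRelations_hom_ext ?_ ?_ (fun i => ?_) fun i => ?_
    · rw [AddMonoidHom.comp_apply, hGy, hFX, hξy]; rfl
    · rw [AddMonoidHom.comp_apply, hGz, hFX, hξz]; rfl
    · rw [AddMonoidHom.comp_apply, hGd, map_sub, hFX, hFX, hξd]; rfl
    · rw [AddMonoidHom.comp_apply, hGe, map_sub, hFX, hFX, hξe]; rfl

end LeafGroup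

/-! ### Quotients of ℤ times a power of ℤ/2 by one element -/

section Quotients

theorem nonempty_quotient_addEquiv {N C : Type*} [AddCommGroup N] [AddCommGroup C]
    {H : AddSubgroup N} (F : N →+ C) (hF : Function.Surjective F) (hH : F.ker = H) :
    Nonempty (N ⧸ H ≃+ C) := by
  subst hH
  exact ⟨QuotientAddGroup.quotientKerEquivOfSurjective F hF⟩

theorem nonempty_quotient_closure_pair_addEquiv {N C : Type*} [AddCommGroup N] [AddCommGroup C]
    {r₁ r₂ r : N} {x : C} (F : N →+ C) (hF : Function.Surjective F)
    (hr₁ : F r₁ ∈ AddSubgroup.zmultiples x) (hr₂ : F r₂ ∈ AddSubgroup.zmultiples x)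
    (hr : r ∈ AddSubgroup.closure {r₁, r₂}) (hx : F r = x)
    (hker : ∀ n, F n = 0 → n ∈ AddSubgroup.closure {r₁, r₂}) :
    Nonempty (N ⧸ AddSubgroup.closure {r₁, r₂} ≃+ C ⧸ AddSubgroup.zmultiples x) := by
  refine nonempty_quotient_addEquiv ((QuotientAddGroup.mk' _).comp F)
    ((QuotientAddGroup.mk'_surjective _).comp hF) (le_antisymm (fun n hn => ?_) ?_)
  · rw [AddMonoidHom.mem_ker, AddMonoidHom.comp_apply, QuotientAddGroup.mk'_apply,
      QuotientAddGroup.eq_zero_iff] at hn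
    obtain ⟨k, hk⟩ := AddSubgroup.mem_zmultiples_iff.1 hn
    rw [← sub_add_cancel n (k • r)]
    refine add_mem (hker _ ?_) (zsmul_mem hr k)
    rw [map_sub, map_zsmul, hx, hk, sub_self]
  · rw [AddSubgroup.closure_le]
    rintro _ (rfl | rfl)
    · exact (QuotientAddGroup.eq_zero_iff _).2 hr₁
    · exact (QuotientAddGroup.eq_zero_iff _).2 hr₂

theorem two_zsmul_eq_zero {W : Type*} [AddCommGroup W] [Module (ZMod 2) W] (w : W) :
    (2 : ℤ) • w = 0 := by
  rw [two_smul, ZModModule.add_self]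

theorem zsmul_of_even {W : Type*} [AddCommGroup W] [Module (ZMod 2) W] {f : ℤ} (hf : Even f)
    (w : W) : f • w = 0 := by
  obtain ⟨k, rfl⟩ := hf
  rw [add_smul, ZModModule.add_self]

theorem zsmul_of_odd {W : Type*} [AddCommGroup W] [Module (ZMod 2) W] {f : ℤ} (hf : Odd f)
    (w : W) : f • w = w := by
  obtain ⟨k, rfl⟩ := hf
  rw [add_smul, zsmul_of_even (even_two_mul k), one_smul, zero_add]

/-- A nonzero vector of a finite-dimensional space is part of a coordinate system. -/
theorem exists_linearEquiv_prod {K W : Type*} [Field K] [AddCommGroup W] [Module K W]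
    [FiniteDimensional K W] {k : ℕ} (hk : Module.finrank K W = k + 1) {w : W} (hw : w ≠ 0) :
    ∃ e : W ≃ₗ[K] K × (Fin k → K), e w = (1, 0) := by
  obtain ⟨q, hq⟩ := Submodule.exists_isCompl (K ∙ w)
  let e₁ : (K × q) ≃ₗ[K] W := ((LinearEquiv.toSpanNonzeroSingleton K W w hw).prodCongr
    (LinearEquiv.refl K q)).trans (Submodule.prodEquivOfIsCompl _ q hq)
  have hfin : Module.finrank K q = k := by
    have := e₁.finrank_eq
    rw [Module.finrank_prod, Module.finrank_self] at this
    omega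
  let e₂ : q ≃ₗ[K] (Fin k → K) := LinearEquiv.ofFinrankEq _ _ (by simp [hfin])
  refine ⟨e₁.symm.trans ((LinearEquiv.refl K K).prodCongr e₂), ?_⟩
  have : e₁.symm w = (1, 0) := by
    rw [LinearEquiv.symm_apply_eq]
    simp [e₁]
  simp [this]

theorem exists_eq_zsmul {U W : Type*} [AddCommGroup U] [AddCommGroup W] [Module (ZMod 2) U]
    [Module (ZMod 2) W] (e : W ≃ₗ[ZMod 2] ZMod 2 × U) {w : W} (he : e w = (1, 0)) {v : W}
    (hv : (e v).2 = 0) : ∃ l : ℤ, v = l • w := by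
  obtain ⟨l, hl⟩ := ZMod.intCast_surjective (e v).1
  refine ⟨l, e.injective (Prod.ext ?_ ?_)⟩
  · rw [map_zsmul, he, ← hl]; simp
  · rw [map_zsmul, he, hv]; simp

theorem two_mul_natCast_zmod (m : ℕ) : (2 * m : ZMod (2 * m)) = 0 := by
  have := ZMod.natCast_self (2 * m)
  rwa [Nat.cast_mul] at this

/-- Multiplication by `m`, as a homomorphism from `ZMod 2` to `ZMod (2 * m)`. -/
def halfHom (m : ℕ) : ZMod 2 →+ ZMod (2 * m) :=
  ZMod.lift 2 ⟨zmultiplesHom _ (m : ZMod (2 * m)), by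
    simp [two_mul_natCast_zmod]⟩

theorem halfHom_one (m : ℕ) : halfHom m 1 = m := zmod_two_lift_one _

variable {W : Type*} [AddCommGroup W] [Module (ZMod 2) W] [FiniteDimensional (ZMod 2) W]

/-- In the quotient `m` times the generator of ℤ equals `w`, a nonzero involution, so this generator
has order `2 * m` and absorbs the line of `w`; a complement of that line survives. -/
theorem twistedCyclic_equiv (m : ℕ) {k : ℕ} (hk : Module.finrank (ZMod 2) W = k + 1) {w : W}
    (hw : w ≠ 0) : Nonempty ((ℤ × W) ⧸ AddSubgroup.zmultiples ((m : ℤ), w) ≃+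
      (Fin k → ZMod 2) × ZMod (2 * m)) := by
  obtain ⟨e, he⟩ := exists_linearEquiv_prod hk hw
  let F : ℤ × W →+ (Fin k → ZMod 2) × ZMod (2 * m) :=
    AddMonoidHom.mk' (fun x => ((e x.2).2, x.1 + halfHom m (e x.2).1)) fun x y => by
      simp only [Prod.fst_add, Prod.snd_add, map_add, Int.cast_add, Prod.mk_add_mk]
      congr 1
      ring
  refine nonempty_quotient_addEquiv F ?_ (le_antisymm ?_ ?_)
  · rintro ⟨v, t⟩
    obtain ⟨i, rfl⟩ := ZMod.intCast_surjective t
    exact ⟨(i, e.symm (0, v)), by simp [F]⟩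
  · rintro ⟨i, v⟩ h
    rw [AddMonoidHom.mem_ker] at h
    simp only [F, AddMonoidHom.mk'_apply, Prod.mk_eq_zero] at h
    obtain ⟨h1, h2⟩ := h
    rw [AddSubgroup.mem_zmultiples_iff]
    obtain ⟨t, rfl⟩ := exists_eq_zsmul e he h1
    have h3 : ((i + t * m : ℤ) : ZMod (2 * m)) = 0 := by
      rw [← h2, map_zsmul, he, Prod.smul_fst, map_zsmul, halfHom_one]
      simp
    rw [ZMod.intCast_zmod_eq_zero_iff_dvd] at h3
    obtain ⟨l, hl⟩ := h3
    push_cast at hl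
    -- From `i + t * m = 2 * m * l`; the sign of `t` does not matter on `w`.
    refine ⟨2 * l - t, Prod.ext ?_ ?_⟩
    · show (2 * l - t) * (m : ℤ) = i
      linarith
    · show (2 * l - t) • w = t • w
      linear_combination (norm := module) (l - t) • two_zsmul_eq_zero w
  · rw [AddSubgroup.zmultiples_le, AddMonoidHom.mem_ker]
    simp [F, he, halfHom_one, ← two_mul, two_mul_natCast_zmod]

/-- For odd `m` the shear `(x, v) ↦ (x, v + x • w)` carries `(m, 0)` to `(m, w)`, so a zero vector
may be traded for a nonzero one. -/
theorem twistedCyclic_equiv_of_odd {m : ℕ} (hm : Odd m) {k : ℕ}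
    (hk : Module.finrank (ZMod 2) W = k + 1) (w : W) :
    Nonempty ((ℤ × W) ⧸ AddSubgroup.zmultiples ((m : ℤ), w) ≃+
      (Fin k → ZMod 2) × ZMod (2 * m)) := by
  by_cases hw : w = 0
  · subst hw
    have : Nontrivial W := Module.nontrivial_of_finrank_pos (R := ZMod 2) (by omega)
    obtain ⟨w, hw⟩ := exists_ne (0 : W)
    obtain ⟨e⟩ := twistedCyclic_equiv m hk hw
    let φ : ℤ × W →+ ℤ × W := AddMonoidHom.mk' (fun x => (x.1, x.2 + x.1 • w)) fun x y => by
      ext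
      · rfl
      · simp; module
    have hm' : Odd (m : ℤ) := by exact_mod_cast hm
    obtain ⟨e'⟩ := nonempty_quotient_addEquiv (H := AddSubgroup.zmultiples ((m : ℤ), (0 : W)))
      ((QuotientAddGroup.mk' (AddSubgroup.zmultiples ((m : ℤ), w))).comp φ)
      ((QuotientAddGroup.mk'_surjective _).comp fun x => ⟨(x.1, x.2 - x.1 • w), by simp [φ]⟩) (by
        ext ⟨i, v⟩
        rw [AddMonoidHom.mem_ker, AddMonoidHom.comp_apply, QuotientAddGroup.mk'_apply,
          QuotientAddGroup.eq_zero_iff, AddSubgroup.mem_zmultiples_iff,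
          AddSubgroup.mem_zmultiples_iff]
        refine exists_congr fun l => ?_
        simp only [φ, AddMonoidHom.mk'_apply, Prod.smul_mk, Prod.mk.injEq, smul_zero]
        refine and_congr_right fun h => ?_
        rw [← h, smul_assoc, smul_comm, zsmul_of_odd hm', eq_comm, add_eq_right, eq_comm])
    exact ⟨e'.trans e⟩
  · exact twistedCyclic_equiv m hk hw

theorem cyclic_equiv {W : Type*} [AddCommGroup W] [Subsingleton W] (m : ℕ) (w : W) :
    Nonempty ((ℤ × W) ⧸ AddSubgroup.zmultiples ((m : ℤ), w) ≃+ ZMod m) := by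
  refine nonempty_quotient_addEquiv ((Int.castAddHom (ZMod m)).comp (AddMonoidHom.fst ℤ W))
    (fun t => ?_) ?_
  · obtain ⟨i, rfl⟩ := ZMod.intCast_surjective t
    exact ⟨(i, 0), rfl⟩
  · ext ⟨i, v⟩
    rw [AddMonoidHom.mem_ker, AddSubgroup.mem_zmultiples_iff]
    simp only [AddMonoidHom.comp_apply, AddMonoidHom.coe_fst, Int.coe_castAddHom,
      ZMod.intCast_zmod_eq_zero_iff_dvd, Prod.smul_mk, Prod.mk.injEq, Subsingleton.elim _ v,
      and_true]
    exact ⟨fun ⟨l, hl⟩ => ⟨l, by rw [hl, smul_eq_mul, mul_comm]⟩,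
      fun ⟨l, hl⟩ => ⟨l, by rw [← hl, smul_eq_mul, mul_comm]⟩⟩

end Quotients

/-! ### Elimination of generators according to parity -/

section LeafGroupStructure

section Relations

variable {W₁ W₂ : Type*} [AddCommGroup W₁] [AddCommGroup W₂] {c c' σ f g : ℤ} {D : W₁} {E : W₂}

theorem leafRelations_left_mem : (c, -2, f • D, 0) ∈ leafRelations c c' σ f g D E :=
  AddSubgroup.subset_closure (Or.inl rfl)

theorem leafRelations_right_mem : (c', -σ, g • D, E) ∈ leafRelations c c' σ f g D E :=
  AddSubgroup.subset_closure (Or.inr rfl)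

theorem mem_leafRelations_of_eq {n : ℤ × ℤ × W₁ × W₂} (x y : ℤ) (h₁ : n.1 = x * c + y * c')
    (h₂ : n.2.1 = x * (-2) + y * (-σ)) (h₃ : n.2.2.1 = x • f • D + y • g • D)
    (h₄ : n.2.2.2 = y • E) : n ∈ leafRelations c c' σ f g D E := by
  have : n = x • (c, -2, f • D, 0) + y • (c', -σ, g • D, E) :=
    Prod.ext h₁ (Prod.ext h₂ (Prod.ext h₃ (by rw [h₄]; simp)))
  rw [this]
  exact add_mem (zsmul_mem leafRelations_left_mem _) (zsmul_mem leafRelations_right_mem _)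

end Relations

variable {W₁ W₂ : Type*} [AddCommGroup W₁] [Module (ZMod 2) W₁] [AddCommGroup W₂]
  [Module (ZMod 2) W₂] {c c' σ f g : ℤ} {D : W₁} {E : W₂}

/-- The first relation reads `2 (z - k y) = 0`: it only makes `z - k y` an involution, which joins
the torsion part. -/
theorem leafGroup_equiv_of_even_even {W₂ : Type*} [AddCommGroup W₂] {E : W₂} {k : ℤ} (hf : Even f) (hc : c = 2 * k) :
    Nonempty ((ℤ × ℤ × W₁ × W₂) ⧸ leafRelations c c' σ f g D E ≃+
      (ℤ × (ZMod 2 × W₁ × W₂)) ⧸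
        AddSubgroup.zmultiples (c' - σ * k, (((-σ : ℤ) : ZMod 2), g • D, E))) := by
  let φ : ℤ × ℤ × W₁ × W₂ →+ ℤ × (ZMod 2 × W₁ × W₂) :=
    AddMonoidHom.mk' (fun x => (x.1 + x.2.1 * k, ((x.2.1 : ZMod 2), x.2.2))) fun x y => by
      ext <;> simp; ring
  have h1 : φ (c, -2, f • D, 0) = 0 := by
    refine Prod.ext ?_ (Prod.ext ?_ (Prod.ext ?_ rfl))
    · show c + -2 * k = 0
      rw [hc]; ring
    · show ((-2 : ℤ) : ZMod 2) = 0
      decide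
    · exact zsmul_of_even hf D
  have h2 : φ (c', -σ, g • D, E) = (c' - σ * k, (((-σ : ℤ) : ZMod 2), g • D, E)) := by
    refine Prod.ext ?_ rfl
    show c' + -σ * k = c' - σ * k
    ring
  refine nonempty_quotient_closure_pair_addEquiv φ ?_ ?_ ?_ leafRelations_right_mem h2 ?_
  · rintro ⟨i, t, v⟩
    obtain ⟨j, rfl⟩ := ZMod.intCast_surjective t
    exact ⟨(i - j * k, j, v), by simp [φ]⟩
  · rw [h1]; exact zero_mem _
  · rw [h2]; exact AddSubgroup.mem_zmultiples _
  · rintro ⟨i, j, v⟩ h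
    simp only [φ, AddMonoidHom.mk'_apply, Prod.mk_eq_zero,
      ZMod.intCast_zmod_eq_zero_iff_dvd] at h
    obtain ⟨h1, ⟨l, rfl⟩, rfl⟩ := h
    push_cast at h1
    refine mem_leafRelations_of_eq (-l) 0 ?_ ?_ ?_ ?_
    · rw [hc]; linarith
    · push_cast; ring
    · simp [zsmul_of_even hf]
    · simp

/-- Put `x = z - k y`. The first relation becomes `y = 2 x + D`, so `x` replaces both `y` and `z`.
-/
theorem leafGroup_equiv_of_odd_odd {W₂ : Type*} [AddCommGroup W₂] {E : W₂} {k : ℤ} (hf : Odd f) (hc : c = 2 * k + 1) :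
    Nonempty ((ℤ × ℤ × W₁ × W₂) ⧸ leafRelations c c' σ f g D E ≃+
      (ℤ × (W₁ × W₂)) ⧸
        AddSubgroup.zmultiples (2 * c' - σ * c, (g • D + (c' - σ * k) • D, E))) := by
  have hD := two_zsmul_eq_zero D
  let φ : ℤ × ℤ × W₁ × W₂ →+ ℤ × (W₁ × W₂) :=
    AddMonoidHom.mk' (fun x => (2 * x.1 + c * x.2.1,
      (x.2.2.1 + (x.1 + k * x.2.1) • D, x.2.2.2))) fun x y => by
      ext
      · simp; ring
      · simp; module
      · simp
  have h1 : φ (c, -2, f • D, 0) = 0 := by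
    refine Prod.ext ?_ (Prod.ext ?_ rfl)
    · show 2 * c + c * -2 = 0
      ring
    · show f • D + (c + k * -2) • D = 0
      rw [zsmul_of_odd hf, hc]
      linear_combination (norm := module) hD
  have h2 : φ (c', -σ, g • D, E) = (2 * c' - σ * c, (g • D + (c' - σ * k) • D, E)) := by
    refine Prod.ext ?_ (Prod.ext ?_ rfl)
    · show 2 * c' + c * -σ = 2 * c' - σ * c
      ring
    · show g • D + (c' + k * -σ) • D = g • D + (c' - σ * k) • D
      module
  refine nonempty_quotient_closure_pair_addEquiv φ ?_ ?_ ?_ leafRelations_right_mem h2 ?_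
  · rintro ⟨i, v, w⟩
    refine ⟨(-k * i, i, v, w), ?_⟩
    simp [φ, hc]; ring
  · rw [h1]; exact zero_mem _
  · rw [h2]; exact AddSubgroup.mem_zmultiples _
  · rintro ⟨i, j, v, w⟩ h
    simp only [φ, AddMonoidHom.mk'_apply, Prod.mk_eq_zero] at h
    obtain ⟨h1, h2, rfl⟩ := h
    obtain ⟨l, rfl⟩ : ∃ l, j = -2 * l := ⟨i + k * j, by rw [hc] at h1; linarith⟩
    obtain rfl : i = c * l := by linarith
    refine mem_leafRelations_of_eq l 0 (by ring) (by ring) ?_ (by simp)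
    show v = l • f • D + (0 : ℤ) • g • D
    rw [zsmul_of_odd hf]
    rw [hc] at h2
    linear_combination (norm := module) h2 - l • hD

/-- Since `σ = 2 μ + 1`, inserting the first relation in the second gives `z = (c' - 2 μ k) y + (g -
μ) D + E`, which eliminates `z`. -/
theorem leafGroup_equiv_of_even_odd {k μ : ℤ} (hf : Odd f) (hc : c = 2 * k)
    (hσ : σ = 2 * μ + 1) :
    Nonempty ((ℤ × ℤ × W₁ × W₂) ⧸ leafRelations c c' σ f g D E ≃+
      (ℤ × (W₁ × W₂)) ⧸ AddSubgroup.zmultiples (2 * c' - σ * c, (D, (0 : W₂)))) := by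
  have hD := two_zsmul_eq_zero D
  have hE := two_zsmul_eq_zero E
  let φ : ℤ × ℤ × W₁ × W₂ →+ ℤ × (W₁ × W₂) :=
    AddMonoidHom.mk' (fun x => (x.1 + x.2.1 * (c' - 2 * μ * k),
      (x.2.2.1 + (x.2.1 * (g - μ)) • D, x.2.2.2 + x.2.1 • E))) fun x y => by
      ext
      · simp; ring
      · simp; module
      · simp; module
  have h1 : φ (c, -2, f • D, 0) = -(2 * c' - σ * c, (D, (0 : W₂))) := by
    refine Prod.ext ?_ (Prod.ext ?_ ?_)
    · show c + -2 * (c' - 2 * μ * k) = -(2 * c' - σ * c)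
      rw [hc, hσ]; ring
    · show f • D + (-2 * (g - μ)) • D = -D
      rw [zsmul_of_odd hf]
      linear_combination (norm := module) (1 - (g - μ)) • hD
    · show (0 : W₂) + (-2 : ℤ) • E = -0
      linear_combination (norm := module) -hE
  have h2 : φ (c', -σ, g • D, E) = μ • φ (c, -2, f • D, 0) := by
    rw [h1]
    refine Prod.ext ?_ (Prod.ext ?_ ?_)
    · show c' + -σ * (c' - 2 * μ * k) = μ * -(2 * c' - σ * c)
      rw [hc, hσ]; ring
    · show g • D + (-σ * (g - μ)) • D = μ • -D
      rw [hσ]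
      linear_combination (norm := module) (μ - μ * (g - μ)) • hD
    · show E + -σ • E = μ • (-0)
      rw [hσ]
      linear_combination (norm := module) -μ • hE
  refine nonempty_quotient_closure_pair_addEquiv φ ?_ ?_ ?_ (neg_mem leafRelations_left_mem) ?_ ?_
  · rintro ⟨i, v, w⟩
    exact ⟨(i, 0, v, w), by simp [φ]⟩
  · rw [h1]
    exact neg_mem (AddSubgroup.mem_zmultiples _)
  · rw [h2, h1]
    exact zsmul_mem (neg_mem (AddSubgroup.mem_zmultiples _)) _
  · rw [map_neg, h1, neg_neg]
  · rintro ⟨i, j, v, w⟩ h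
    simp only [φ, AddMonoidHom.mk'_apply, Prod.mk_eq_zero] at h
    obtain ⟨h1, h2, h3⟩ := h
    refine mem_leafRelations_of_eq (j * μ) (-j) ?_ ?_ ?_ ?_
    · rw [hc]; linarith
    · rw [hσ]; ring
    · show v = (j * μ) • f • D + -j • g • D
      rw [zsmul_of_odd hf]
      linear_combination (norm := module) h2
    · show w = -j • E
      linear_combination (norm := module) h3

/-- For `x = z - k y` the relations become `2 x = D` and `m y = (g - μ) D + E`. As `D` and `E` are
nonzero, `x` has order 4 and `y` has order `2 * m`; complements of the lines of `D` and `E` remain.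
-/
theorem leafGroup_equiv_of_all_even [FiniteDimensional (ZMod 2) W₁]
    [FiniteDimensional (ZMod 2) W₂] {k μ : ℤ} (hf : Odd f) (hc : c = 2 * k) (hσ : σ = 2 * μ)
    (hD : D ≠ 0) (hE : E ≠ 0) {k₁ k₂ m : ℕ} (hm : c' - σ * k = m)
    (hk₁ : Module.finrank (ZMod 2) W₁ = k₁ + 1) (hk₂ : Module.finrank (ZMod 2) W₂ = k₂ + 1) :
    Nonempty ((ℤ × ℤ × W₁ × W₂) ⧸ leafRelations c c' σ f g D E ≃+
      (Fin (k₁ + k₂) → ZMod 2) × ZMod 4 × ZMod (2 * m)) := by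
  obtain ⟨e₁, he₁⟩ := exists_linearEquiv_prod hk₁ hD
  obtain ⟨e₂, he₂⟩ := exists_linearEquiv_prod hk₂ hE
  let e₃ : ((Fin k₁ → ZMod 2) × (Fin k₂ → ZMod 2)) ≃ₗ[ZMod 2] (Fin (k₁ + k₂) → ZMod 2) :=
    LinearEquiv.ofFinrankEq _ _ (by simp)
  let τ : ZMod 2 →+ ZMod 4 := halfHom 2
  have hτ : τ 1 = 2 := halfHom_one 2
  have hτg : τ (g : ZMod 2) = g * 2 := by
    rw [← zsmul_one, map_zsmul, hτ, zsmul_eq_mul]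
  let F : ℤ × ℤ × W₁ × W₂ →+ (Fin (k₁ + k₂) → ZMod 2) × ZMod 4 × ZMod (2 * m) :=
    AddMonoidHom.mk' (fun x => (e₃ ((e₁ x.2.2.1).2, (e₂ x.2.2.2).2),
      (x.2.1 + τ (e₁ x.2.2.1).1 + ((g - μ : ℤ) : ZMod 4) * τ (e₂ x.2.2.2).1,
        x.1 + k * x.2.1 + halfHom m (e₂ x.2.2.2).1))) fun x y => by
      refine Prod.ext ?_ (Prod.ext ?_ ?_)
      · simp only [Prod.fst_add, Prod.snd_add, map_add, ← Prod.mk_add_mk]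
      · simp only [Prod.fst_add, Prod.snd_add, map_add, Int.cast_add]
        ring
      · simp only [Prod.fst_add, Prod.snd_add, map_add, Int.cast_add]
        ring
  refine nonempty_quotient_addEquiv F ?_ (le_antisymm ?_ ?_)
  · rintro ⟨u, s, t⟩
    obtain ⟨j, rfl⟩ := ZMod.intCast_surjective s
    obtain ⟨i, rfl⟩ := ZMod.intCast_surjective t
    exact ⟨(i - k * j, j, e₁.symm (0, (e₃.symm u).1), e₂.symm (0, (e₃.symm u).2)), by simp [F]⟩
  · rintro ⟨i, j, v, w⟩ h
    rw [AddMonoidHom.mem_ker] at h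
    simp only [F, AddMonoidHom.mk'_apply, Prod.mk_eq_zero, LinearEquiv.map_eq_zero_iff] at h
    obtain ⟨⟨h1, h2⟩, h3, h4⟩ := h
    obtain ⟨A, rfl⟩ := exists_eq_zsmul e₁ he₁ h1
    obtain ⟨B, rfl⟩ := exists_eq_zsmul e₂ he₂ h2
    have h3' : ((j + A * 2 + (g - μ) * (B * 2) : ℤ) : ZMod 4) = 0 := by
      rw [← h3, map_zsmul, map_zsmul, he₁, he₂, Prod.smul_fst, Prod.smul_fst, map_zsmul,
        map_zsmul, hτ]
      simp
    have h4' : ((i + k * j + B * m : ℤ) : ZMod (2 * m)) = 0 := by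
      rw [← h4, map_zsmul, he₂, Prod.smul_fst, map_zsmul, halfHom_one]
      simp
    rw [ZMod.intCast_zmod_eq_zero_iff_dvd] at h3' h4'
    obtain ⟨l, hl⟩ := h3'
    obtain ⟨t, ht⟩ := h4'
    push_cast at hl ht
    -- The first coordinate, with `c' = m + σ * k`, gives the multiple `2 * t - B` of the second
    -- relation; the second coordinate then gives the other multiple.
    refine mem_leafRelations_of_eq (-2 * l + A + g * B - 2 * μ * t) (2 * t - B) ?_ ?_ ?_ ?_
    · show i = _
      rw [hc]
      linear_combination ht - k * hl - (2 * t - B) * hm - (2 * t - B) * k * hσ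
    · show j = _
      rw [hσ]
      linear_combination hl
    · show A • D = _ • f • D + _ • g • D
      rw [zsmul_of_odd hf]
      linear_combination (norm := module) (l + μ * t - t * g) • two_zsmul_eq_zero D
    · show B • E = _
      linear_combination (norm := module) (B - t) • two_zsmul_eq_zero E
  · rw [leafRelations, AddSubgroup.closure_le]
    rintro _ (rfl | rfl)
    · rw [SetLike.mem_coe, AddMonoidHom.mem_ker, zsmul_of_odd hf]
      refine Prod.ext ?_ (Prod.ext ?_ ?_)
      · simp [F, he₁]
      · simp [F, he₁, hτ]
      · simp [F, hc]; ring
    · rw [SetLike.mem_coe, AddMonoidHom.mem_ker]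
      refine Prod.ext ?_ (Prod.ext ?_ ?_)
      · simp [F, he₁, he₂]
      · simp [F, he₁, he₂, hτ, hτg, hσ]
        have : (4 : ZMod 4) = 0 := rfl
        linear_combination (g - μ) * this
      · have := two_mul_natCast_zmod m
        have hm' : (c' : ZMod (2 * m)) - σ * k = m := by
          exact_mod_cast congrArg (Int.cast : ℤ → ZMod (2 * m)) hm
        simp [F, he₂, halfHom_one]
        linear_combination hm' + this

end LeafGroupStructure

/-! ### Parity and positivity of the coefficients, and their link with `bSeq` -/

section Parity

theorem even_pathSeq_add (κ k : ℕ) :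
    Even (pathSeq (2 : ℤ) (κ + 5) k + (κ + 1) * pathSeq (0 : ℤ) (-1) k) := by
  induction k using Nat.strong_induction_on with
  | _ k ih =>
    match k with
    | 0 => exact ⟨1, by simp [pathSeq]⟩
    | 1 => exact ⟨2, by simp [pathSeq]; ring⟩
    | k + 2 =>
      obtain ⟨u, hu⟩ := ih k (by omega)
      obtain ⟨v, hv⟩ := ih (k + 1) (by omega)
      refine ⟨3 * v - u, ?_⟩
      rw [pathSeq_add_two, pathSeq_add_two, nsmul_eq_mul, nsmul_eq_mul]
      push_cast
      linear_combination 3 * hv - hu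

/-- Modulo 2 this is the Fibonacci recurrence started at 0, 1, which has period 3. -/
theorem even_pathSeq_iff (k : ℕ) : Even (pathSeq (0 : ℤ) (-1) k) ↔ k % 3 = 0 := by
  induction k using Nat.strong_induction_on with
  | _ k ih =>
    match k with
    | 0 => simp [pathSeq]
    | 1 => simp [pathSeq]
    | 2 => simp [pathSeq]; decide
    | k + 3 =>
      have h : pathSeq (0 : ℤ) (-1) (k + 3) =
          2 * (4 * pathSeq (0 : ℤ) (-1) (k + 1) - pathSeq (0 : ℤ) (-1) k) -
            pathSeq (0 : ℤ) (-1) k := by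
        rw [pathSeq_add_two, pathSeq_add_two, nsmul_eq_mul, nsmul_eq_mul]
        push_cast
        ring
      rw [h, Int.even_sub, ih k (by omega)]
      simp

theorem pathSeq_pos_and_le (κ k : ℕ) : 0 < pathSeq (2 : ℤ) (κ + 5) k ∧
    pathSeq (2 : ℤ) (κ + 5) k ≤ pathSeq (2 : ℤ) (κ + 5) (k + 1) := by
  induction k with
  | zero => simp only [pathSeq]; omega
  | succ k ih =>
    rw [pathSeq_add_two, nsmul_eq_mul]
    push_cast
    constructor <;> linarith [ih.1, ih.2]

/-- Every second term of a Fibonacci-type sequence satisfies `u (k + 2) = 3 u (k + 1) - u k`; the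
terms between are differences. -/
theorem bSeq_eq_pathSeq (κ k : ℕ) :
    bSeq (κ + 1) (2 * k) = 2 ^ κ * pathSeq (2 : ℤ) (κ + 5) k ∧
      bSeq (κ + 1) (2 * k + 1) =
        2 ^ κ * (pathSeq (2 : ℤ) (κ + 5) (k + 1) - pathSeq (2 : ℤ) (κ + 5) k) := by
  induction k with
  | zero =>
    constructor
    · simp [bSeq, pathSeq, pow_succ]
    · simp [bSeq, pathSeq]
      ring
  | succ k ih =>
    have h0 : bSeq (κ + 1) (2 * (k + 1)) = 2 ^ κ * pathSeq (2 : ℤ) (κ + 5) (k + 1) := by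
      rw [mul_add, mul_one, bSeq, ih.1, ih.2]; ring
    refine ⟨h0, ?_⟩
    have h1 : bSeq (κ + 1) (2 * (k + 1) + 1) =
      bSeq (κ + 1) (2 * (k + 1)) + bSeq (κ + 1) (2 * k + 1) := rfl
    rw [h1, h0, ih.2, pathSeq_add_two, nsmul_eq_mul]
    push_cast
    ring

end Parity

theorem one_ne_zero_of_pos {κ : ℕ} (h : 0 < κ) : (1 : Fin κ → ZMod 2) ≠ 0 := by
  intro h'
  have := congrFun h' ⟨0, h⟩
  exact absurd this (by simp)

/-! ### The leaf group in the four cases -/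

section Structure

variable {n κ₁ κ₂ a : ℕ}

theorem leafGroup_structure_of_mod_eq_zero
    (ha : (a : ℤ) = 2 * (pathSeq (2 : ℤ) (κ₁ + 5) (n + 1) + κ₂ * pathSeq (2 : ℤ) (κ₁ + 5) n) -
      (κ₂ + 1) * pathSeq (2 : ℤ) (κ₁ + 5) n) (hn : n % 3 = 0) :
    Nonempty ((ℤ × ℤ × (Fin κ₁ → ZMod 2) × (Fin κ₂ → ZMod 2)) ⧸ coneRelations n κ₁ κ₂ ≃+
      (Fin (κ₁ + κ₂) → ZMod 2) × ZMod a) := by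
  have hf := (even_pathSeq_iff n).2 hn
  have hc := (Int.even_add.1 (even_pathSeq_add κ₁ n)).2 (hf.mul_left _)
  rw [even_iff_exists_two_mul] at hc
  obtain ⟨k, hc⟩ := hc
  obtain ⟨m, rfl⟩ : ∃ m, a = 2 * m := by
    have : (2 : ℤ) ∣ a := by
      rw [ha, hc]
      exact dvd_sub (dvd_mul_right _ _) ((dvd_mul_right _ _).mul_left _)
    exact_mod_cast this
  obtain ⟨e⟩ := leafGroup_equiv_of_even_even (g := pathSeq (0 : ℤ) (-1) (n + 1) +
    κ₂ * pathSeq (0 : ℤ) (-1) n) (c' := pathSeq (2 : ℤ) (κ₁ + 5) (n + 1) +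
    κ₂ * pathSeq (2 : ℤ) (κ₁ + 5) n) (σ := κ₂ + 1) (D := (1 : Fin κ₁ → ZMod 2))
    (E := (1 : Fin κ₂ → ZMod 2)) hf hc
  have hm : pathSeq (2 : ℤ) (κ₁ + 5) (n + 1) + κ₂ * pathSeq (2 : ℤ) (κ₁ + 5) n - (κ₂ + 1) * k =
      m := by
    push_cast at ha
    rw [hc] at ha ⊢
    linarith
  rw [hm] at e
  obtain ⟨e'⟩ := twistedCyclic_equiv m (k := κ₁ + κ₂)
    (w := ((((-(κ₂ + 1) : ℤ) : ZMod 2), (pathSeq (0 : ℤ) (-1) (n + 1) +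
      κ₂ * pathSeq (0 : ℤ) (-1) n) • (1 : Fin κ₁ → ZMod 2), (1 : Fin κ₂ → ZMod 2))))
    (by simp; ring) (by
      -- For `κ₂ = 0` the component `-(κ₂ + 1)` is odd; otherwise the last component is nonzero.
      rcases Nat.eq_zero_or_pos κ₂ with rfl | h
      · simp
      · simp [one_ne_zero_of_pos h])
  exact ⟨e.trans e'⟩

theorem leafGroup_structure_of_odd
    (ha : (a : ℤ) = 2 * (pathSeq (2 : ℤ) (κ₁ + 5) (n + 1) + κ₂ * pathSeq (2 : ℤ) (κ₁ + 5) n) -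
      (κ₂ + 1) * pathSeq (2 : ℤ) (κ₁ + 5) n) (hn : n % 3 ≠ 0) {k : ℕ} (hk : κ₁ + κ₂ = k + 1)
    (h : Odd (κ₁ + 1) ∨ Odd (κ₂ + 1)) :
    Nonempty ((ℤ × ℤ × (Fin κ₁ → ZMod 2) × (Fin κ₂ → ZMod 2)) ⧸ coneRelations n κ₁ κ₂ ≃+
      (Fin k → ZMod 2) × ZMod (2 * a)) := by
  have hf : Odd (pathSeq (0 : ℤ) (-1) n) := by
    rwa [← Int.not_even_iff_odd, even_pathSeq_iff]
  have hcf := even_pathSeq_add κ₁ n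
  have hfin : Module.finrank (ZMod 2) ((Fin κ₁ → ZMod 2) × (Fin κ₂ → ZMod 2)) = k + 1 := by
    simp [hk]
  rcases Nat.even_or_odd (κ₁ + 1) with h₁ | h₁
  · have h₁' : Even ((κ₁ : ℤ) + 1) := by exact_mod_cast h₁
    have hc := (Int.even_add.1 hcf).2 (h₁'.mul_right _)
    rw [even_iff_exists_two_mul] at hc
    obtain ⟨c, hc⟩ := hc
    obtain ⟨μ, hμ⟩ := h.resolve_left (Nat.not_odd_iff_even.2 h₁)
    obtain ⟨e⟩ := leafGroup_equiv_of_even_odd (g := pathSeq (0 : ℤ) (-1) (n + 1) +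
      κ₂ * pathSeq (0 : ℤ) (-1) n) (c' := pathSeq (2 : ℤ) (κ₁ + 5) (n + 1) +
      κ₂ * pathSeq (2 : ℤ) (κ₁ + 5) n) (σ := κ₂ + 1) (D := (1 : Fin κ₁ → ZMod 2))
      (E := (1 : Fin κ₂ → ZMod 2)) (μ := μ) hf hc (by exact_mod_cast hμ)
    rw [← ha] at e
    have hκ : 0 < κ₁ := by
      obtain ⟨r, hr⟩ := h₁; omega
    obtain ⟨e'⟩ := twistedCyclic_equiv a hfin
      (w := ((1 : Fin κ₁ → ZMod 2), (0 : Fin κ₂ → ZMod 2))) (by simp [one_ne_zero_of_pos hκ])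
    exact ⟨e.trans e'⟩
  · have h₁' : Odd ((κ₁ : ℤ) + 1) := by exact_mod_cast h₁
    have hc : Odd (pathSeq (2 : ℤ) (κ₁ + 5) n) := by
      rw [← Int.not_even_iff_odd, Int.even_add.1 hcf, Int.not_even_iff_odd]
      exact h₁'.mul hf
    have hodd := hc
    obtain ⟨c, hc⟩ := hc
    obtain ⟨e⟩ := leafGroup_equiv_of_odd_odd (g := pathSeq (0 : ℤ) (-1) (n + 1) +
      κ₂ * pathSeq (0 : ℤ) (-1) n) (c' := pathSeq (2 : ℤ) (κ₁ + 5) (n + 1) +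
      κ₂ * pathSeq (2 : ℤ) (κ₁ + 5) n) (σ := κ₂ + 1) (D := (1 : Fin κ₁ → ZMod 2))
      (E := (1 : Fin κ₂ → ZMod 2)) hf hc
    rw [← ha] at e
    -- For `κ₂ = 0` the torsion vector may vanish, but then `a` is odd because `c` is.
    rcases Nat.eq_zero_or_pos κ₂ with rfl | hκ
    · have ha' : Odd a := by
        have : Odd (a : ℤ) := by
          rw [ha]
          refine Even.sub_odd (even_two_mul _) ?_
          simpa using hodd
        exact_mod_cast this
      obtain ⟨e'⟩ := twistedCyclic_equiv_of_odd ha' hfin _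
      exact ⟨e.trans e'⟩
    · obtain ⟨e'⟩ := twistedCyclic_equiv a hfin (w := ((_ : Fin κ₁ → ZMod 2),
        (1 : Fin κ₂ → ZMod 2))) (by simp [one_ne_zero_of_pos hκ])
      exact ⟨e.trans e'⟩

theorem leafGroup_structure_of_single_leaves
    (ha : (a : ℤ) = 2 * (pathSeq (2 : ℤ) ((0 : ℕ) + 5) (n + 1) +
      (0 : ℕ) * pathSeq (2 : ℤ) ((0 : ℕ) + 5) n) -
      ((0 : ℕ) + 1) * pathSeq (2 : ℤ) ((0 : ℕ) + 5) n) (hn : n % 3 ≠ 0) :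
    Nonempty ((ℤ × ℤ × (Fin 0 → ZMod 2) × (Fin 0 → ZMod 2)) ⧸ coneRelations n 0 0 ≃+
      ZMod a) := by
  have hf : Odd (pathSeq (0 : ℤ) (-1) n) := by
    rwa [← Int.not_even_iff_odd, even_pathSeq_iff]
  have hc : Odd (pathSeq (2 : ℤ) ((0 : ℕ) + 5) n) := by
    rw [← Int.not_even_iff_odd, Int.even_add.1 (even_pathSeq_add 0 n), Int.not_even_iff_odd]
    simpa using hf
  obtain ⟨c, hc⟩ := hc
  obtain ⟨e⟩ := leafGroup_equiv_of_odd_odd (g := pathSeq (0 : ℤ) (-1) (n + 1) +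
    (0 : ℕ) * pathSeq (0 : ℤ) (-1) n) (c' := pathSeq (2 : ℤ) ((0 : ℕ) + 5) (n + 1) +
    (0 : ℕ) * pathSeq (2 : ℤ) ((0 : ℕ) + 5) n) (σ := (0 : ℕ) + 1) (D := (1 : Fin 0 → ZMod 2))
    (E := (1 : Fin 0 → ZMod 2)) hf hc
  rw [← ha] at e
  obtain ⟨e'⟩ := cyclic_equiv (W := (Fin 0 → ZMod 2) × (Fin 0 → ZMod 2)) a _
  exact ⟨e.trans e'⟩

theorem leafGroup_structure_of_even {k₁ k₂ : ℕ}
    (ha : (a : ℤ) = 2 * (pathSeq (2 : ℤ) ((k₁ + 1 : ℕ) + 5) (n + 1) +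
      (k₂ + 1 : ℕ) * pathSeq (2 : ℤ) ((k₁ + 1 : ℕ) + 5) n) -
      ((k₂ + 1 : ℕ) + 1) * pathSeq (2 : ℤ) ((k₁ + 1 : ℕ) + 5) n) (hn : n % 3 ≠ 0)
    (h₁ : Even k₁) (h₂ : Even k₂) :
    Nonempty ((ℤ × ℤ × (Fin (k₁ + 1) → ZMod 2) × (Fin (k₂ + 1) → ZMod 2)) ⧸
      coneRelations n (k₁ + 1) (k₂ + 1) ≃+ (Fin (k₁ + k₂) → ZMod 2) × ZMod 4 × ZMod a) := by
  have hf : Odd (pathSeq (0 : ℤ) (-1) n) := by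
    rwa [← Int.not_even_iff_odd, even_pathSeq_iff]
  have h₁' : Even (((k₁ + 1 : ℕ) : ℤ) + 1) := by
    obtain ⟨r, rfl⟩ := h₁
    exact ⟨r + 1, by push_cast; ring⟩
  have hc := (Int.even_add.1 (even_pathSeq_add (k₁ + 1) n)).2 (h₁'.mul_right _)
  rw [even_iff_exists_two_mul] at hc
  obtain ⟨c, hc⟩ := hc
  obtain ⟨μ, hμ⟩ := h₂
  obtain ⟨m, rfl⟩ : ∃ m, a = 2 * m := by
    have : (2 : ℤ) ∣ a := by
      rw [ha, hc]
      exact dvd_sub (dvd_mul_right _ _) ((dvd_mul_right _ _).mul_left _)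
    exact_mod_cast this
  refine leafGroup_equiv_of_all_even (k := c) (μ := μ + 1) hf hc (by rw [hμ]; push_cast; ring)
    (one_ne_zero_of_pos k₁.succ_pos) (one_ne_zero_of_pos k₂.succ_pos) ?_ (by simp) (by simp)
  push_cast at ha hc ⊢
  rw [hc] at ha ⊢
  linarith

end Structure

theorem theorem1p3 (p s₁ s₂ : ℕ) (hp : 1 ≤ p) (hs₁ : 1 ≤ s₁) (hs₂ : 1 ≤ s₂) :
    ∃ a : ℕ, 0 < a ∧
      (a : ℚ) = (2 : ℚ) ^ (1 - (s₁ : ℤ)) *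
        (2 * bSeq s₁ (2 * p - 1) + s₂ * bSeq s₁ (2 * p - 2)) ∧
      (a : ℚ) = tNumber p s₁ s₂ / 2 ^ (s₁ + s₂ - 2) ∧
      ∀ q : Option (BiCoconutVertex p s₁ s₂),
        (p % 3 = 1 →
          Nonempty (SandpileGroup (coneGraph (biCoconutTree p s₁ s₂)) q ≃+
            (Fin (s₁ + s₂ - 2) → ZMod 2) × ZMod a)) ∧
        (p % 3 ≠ 1 → (Odd s₁ ∨ Odd s₂) → 3 ≤ s₁ + s₂ →
          Nonempty (SandpileGroup (coneGraph (biCoconutTree p s₁ s₂)) q ≃+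
            (Fin (s₁ + s₂ - 3) → ZMod 2) × ZMod (2 * a))) ∧
        (p % 3 ≠ 1 → s₁ = 1 → s₂ = 1 →
          Nonempty (SandpileGroup (coneGraph (biCoconutTree p s₁ s₂)) q ≃+ ZMod a)) ∧
        (p % 3 ≠ 1 → Even s₁ → Even s₂ →
          Nonempty (SandpileGroup (coneGraph (biCoconutTree p s₁ s₂)) q ≃+
            (Fin (s₁ + s₂ - 4) → ZMod 2) × ZMod 4 × ZMod a)) := by
  -- Since `p = n + 1`, the condition `p % 3 = 1` becomes `n % 3 = 0`.
  obtain ⟨n, rfl⟩ := Nat.exists_eq_add_of_le' hp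
  obtain ⟨κ₁, rfl⟩ := Nat.exists_eq_add_of_le' hs₁
  obtain ⟨κ₂, rfl⟩ := Nat.exists_eq_add_of_le' hs₂
  obtain ⟨hc0, hc1⟩ := pathSeq_pos_and_le κ₁ n
  obtain ⟨hb0, hb1⟩ := bSeq_eq_pathSeq κ₁ n
  -- This is the determinant of the integer parts of the two relations; it equals `2 c_{n+1} + (κ₂ -
  -- 1) c_n`, positive because `0 < c_n ≤ c_{n+1}`.
  obtain ⟨a, ha⟩ := Int.eq_ofNat_of_zero_le (a := 2 * (pathSeq (2 : ℤ) (κ₁ + 5) (n + 1) +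
    κ₂ * pathSeq (2 : ℤ) (κ₁ + 5) n) - (κ₂ + 1) * pathSeq (2 : ℤ) (κ₁ + 5) n) (by nlinarith)
  have hq : (a : ℚ) = 2 * (pathSeq (2 : ℤ) (κ₁ + 5) (n + 1) +
      κ₂ * pathSeq (2 : ℤ) (κ₁ + 5) n) - (κ₂ + 1) * pathSeq (2 : ℤ) (κ₁ + 5) n := by
    exact_mod_cast (congrArg (Int.cast : ℤ → ℚ) ha).symm
  have e1 : 2 * (n + 1) - 1 = 2 * n + 1 := by omega
  have e2 : 2 * (n + 1) - 2 = 2 * n := by omega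
  have e3 : κ₁ + 1 + (κ₂ + 1) - 2 = κ₁ + κ₂ := by omega
  refine ⟨a, ?_, ?_, ?_, fun q => ?_⟩
  · have : (0 : ℤ) < a := by rw [← ha]; nlinarith
    exact_mod_cast this
  · rw [e1, e2, hb0, hb1, hq]
    have : (1 : ℤ) - ((κ₁ + 1 : ℕ) : ℤ) = -(κ₁ : ℤ) := by push_cast; ring
    rw [this, zpow_neg, zpow_natCast]
    field_simp
    push_cast
    ring
  · rw [tNumber, e1, e2, e3, hb0, hb1, hq]
    have : ((κ₂ + 1 : ℕ) : ℤ) - 1 = (κ₂ : ℤ) := by push_cast; ring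
    rw [this, zpow_natCast, pow_add]
    field_simp
    push_cast
    ring
  obtain ⟨e⟩ := sandpile_equiv_leafGroup q
  refine ⟨fun hn => ?_, fun hn ho hs => ?_, fun hn h₁ h₂ => ?_, fun hn h₁ h₂ => ?_⟩
  · rw [e3]
    obtain ⟨e'⟩ := leafGroup_structure_of_mod_eq_zero ha.symm (by omega)
    exact ⟨e.trans e'⟩
  · obtain ⟨e'⟩ := leafGroup_structure_of_odd (k := κ₁ + 1 + (κ₂ + 1) - 3) ha.symm (by omega)
      (by omega) ho
    exact ⟨e.trans e'⟩
  · obtain rfl : κ₁ = 0 := by omega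
    obtain rfl : κ₂ = 0 := by omega
    obtain ⟨e'⟩ := leafGroup_structure_of_single_leaves ha.symm (by omega)
    exact ⟨e.trans e'⟩
  · obtain ⟨r₁, hr₁⟩ := h₁
    obtain ⟨r₂, hr₂⟩ := h₂
    obtain ⟨k₁, rfl⟩ : ∃ k, κ₁ = k + 1 := ⟨κ₁ - 1, by omega⟩
    obtain ⟨k₂, rfl⟩ : ∃ k, κ₂ = k + 1 := ⟨κ₂ - 1, by omega⟩
    have e4 : k₁ + 1 + 1 + (k₂ + 1 + 1) - 4 = k₁ + k₂ := by omega
    rw [e4]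
    obtain ⟨e'⟩ := leafGroup_structure_of_even ha.symm (by omega) ⟨r₁ - 1, by omega⟩
      ⟨r₂ - 1, by omega⟩
    exact ⟨e.trans e'⟩
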